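/- Let $V(x)=\kappa|x|^\alpha+\varphi(x)$ with $\alpha\ge 1$, $\kappa>0$, where $\varphi:\mathbb{R}\to\mathbb{R}$ is measurable, bounded below on compact sets, $\mathcal C^2$ outside a compact set, and, as $|x|\to\infty$, $\varphi(x)=o(|x|^\alpha)$, $\varphi'(x)=o(|x|^{\alpha-1})$ and $\sup_{y\in[a,b]}\varphi''(x+y)=o(|x|^{\alpha-2})$ for all $a<b$. Let either $g(x)=-\log|x|$ (log case) or $g(x)=|x|^{-s}$ with $0<s<1$ (Riesz case), let $P>0$, and let $(\beta_N)_{N\ge1}$ be positive reals with $N\beta_N\to 2P$ as $N\to\infty$. Let $\mathbb P_N$ be the probability measure on $\mathbb{R}^N$ given by $$d\mathbb P_N(x_1,\dots,x_N)=\frac1{\mathcal Z_N}\prod_{1\le i<j\le N}e^{-\beta_N g(x_i-x_j)}\prod_{i=1}^N e^{-V(x_i)}\,dx_1\cdots dx_N,$$ where $\mathcal Z_N$ is the normalization constant, and let $x_{\max}=\max_{1\le i\le N}x_i$. Then, in both cases, for all $0<x<1$, $$\limsup_{N\to\infty}\frac1{\log N}\log\log\frac1{\mathbb P_N\left(\dfrac{x_{\max}}{(\kappa^{-1}\log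 N)^{1/\alpha}}<1-x\right)}\ \ge\ 1-(1-x)^\alpha .$$ -/

import Mathlib

open Filter MeasureTheory Topology Asymptotics

noncomputable section

namespace RieszGas

/-- The logarithmic two-body repulsion `g(x) = -log |x|`. (The value at the origin only affects
configurations with two coinciding particles, a Lebesgue-null set.) -/
def logInteraction (x : ℝ) : ℝ := -Real.log |x|

/-- The Riesz two-body repulsion `g(x) = |x|^{-s}`. (The value at the origin only affects
configurations with two coinciding particles, a Lebesgue-null set.) -/
def rieszInteraction (s : ℝ) (x : ℝ) : ℝ := |x| ^ (-s)

/-- The confining potential `V(x) = κ |x|^α + φ(x)`. -/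
def potential (κ α : ℝ) (φ : ℝ → ℝ) (x : ℝ) : ℝ := κ * |x| ^ α + φ x

/-- The standing assumptions on the potential `V(x) = κ |x|^α + φ(x)`. The filter `cocompact ℝ`
is `|x| → ∞`. The first two regularity fields are what is needed for `e^{-V}` to be a locally
bounded measurable weight; outside of a compact set they follow from `contDiff_outside`. -/
structure PotentialAssumptions (κ α : ℝ) (φ : ℝ → ℝ) : Prop where
  one_le_alpha : 1 ≤ α
  kappa_pos : 0 < κ
  measurable : Measurable φ
  locally_bddBelow : ∀ K : Set ℝ, IsCompact K → BddBelow (φ '' K)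
  isLittleO : φ =o[cocompact ℝ] fun x : ℝ => |x| ^ α
  contDiff_outside : ∃ K : Set ℝ, IsCompact K ∧ ContDiffOn ℝ 2 φ Kᶜ
  deriv_isLittleO : deriv φ =o[cocompact ℝ] fun x : ℝ => |x| ^ (α - 1)
  deriv2_isLittleO : ∀ a b : ℝ, a < b →
    (fun x : ℝ => sSup ((fun y : ℝ => deriv (deriv φ) (x + y)) '' Set.Icc a b))
      =o[cocompact ℝ] fun x : ℝ => |x| ^ (α - 2)

/-- The unnormalized density `∏_{i<j} e^{-β g(x_i - x_j)} ∏_i e^{-V(x_i)}` on `ℝ^N`. -/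
def gibbsWeight (g V : ℝ → ℝ) (β : ℝ) (N : ℕ) (x : Fin N → ℝ) : ℝ :=
  (∏ i : Fin N, ∏ j ∈ Finset.Ioi i, Real.exp (-β * g (x i - x j))) *
    ∏ i : Fin N, Real.exp (-V (x i))

/-- The partition function `Z_N`, the Lebesgue integral of the unnormalized density. -/
def partitionFunction (g V : ℝ → ℝ) (β : ℝ) (N : ℕ) : ENNReal :=
  ∫⁻ x : Fin N → ℝ, ENNReal.ofReal (gibbsWeight g V β N x)

/-- The Gibbs measure `P_N` of the gas: density `gibbsWeight / Z_N` with respect to the Lebesgue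
measure on `ℝ^N`. -/
def gibbsMeasure (g V : ℝ → ℝ) (β : ℝ) (N : ℕ) : Measure (Fin N → ℝ) :=
  (partitionFunction g V β N)⁻¹ •
    (volume : Measure (Fin N → ℝ)).withDensity fun x => ENNReal.ofReal (gibbsWeight g V β N x)

/-- The top particle `x_max = max_i x_i`. -/
def topParticle {N : ℕ} (x : Fin N → ℝ) : ℝ := ⨆ i, x i

/-- The probability `P_N (x_max / (κ⁻¹ log N)^{1/α} < t)`. -/
def leftDeviationProb (g V : ℝ → ℝ) (β κ α : ℝ) (N : ℕ) (t : ℝ) : ℝ :=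
  (gibbsMeasure g V β N).real
    {x : Fin N → ℝ | topParticle x / (κ⁻¹ * Real.log N) ^ (1 / α) < t}

end RieszGas

end

/-!
The top particle is pushed below `T = (1 - x) (κ⁻¹ log N)^{1/α}` by confining the particles one
after the other. Conditionally on the positions of all the other particles, a given particle lies
above `T` with probability at least `ε = N^{-(1-x)^α - o(1)}`, uniformly in those positions
(`ofReal_mul_lintegral_le_setLIntegral_Ici`); hence all `N` particles lie below `T` with probability
at most `(1 - ε)^N ≤ exp (-N^{1 - (1-x)^α - o(1)})` (`setLIntegral_forall_lt_le`), and taking two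
logarithms gives the claim.

The uniform lower bound on the conditional probability uses `N β_N = O(1)`. Given the others at
`a_j`, the particle has density proportional to `e^{-V(y)} ∏ e^{-β g(y - a_j)}`. In the Riesz case
the interaction factor is at most `1`. In the logarithmic case it is at most
`∏ ((1 + |y|) (1 + T) (1 + |a_j - T|))^β`, where the first two factors contribute only a polynomial
in `y` and in `T` as `N β_N` is bounded, and `T` is of order `(log N)^{1/α}`. Conversely, on
`[T, T + 1]` the interaction factor is at least a constant times `∏ (1 + |a_j - T|)^β` outside of a
set of measure at most `1/2`: the singularity of `g` at the origin is integrable, so Markov's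
inequality bounds the total repulsion. The unbounded factor `∏ (1 + |a_j - T|)^β` therefore cancels,
and what is left is `e^{-V}` on `[T, T + 1]`, which is `N^{-(1-x)^α + o(1)}`. The two cases are
treated together through `IsTameInteraction`.
-/

namespace RieszGas

/-! ### Two-body interactions -/

/-- The common features of the logarithmic (`c = 1`) and Riesz (`c = 0`) interactions used below:
evenness, growth at infinity no faster than `-c log (1 + |u|)`, and a singularity at the origin no
worse than `|u|^{-s}`, uniformly with respect to translations of the unit interval. -/
structure IsTameInteraction (g : ℝ → ℝ) (s c C : ℝ) : Prop where
  measurable : Measurable g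
  even : ∀ u, g (-u) = g u
  neg_le : ∀ u, -g u ≤ c * Real.log (1 + |u|)
  le_singular : ∀ y ∈ Set.Icc (0 : ℝ) 1, ∀ a : ℝ,
    g (y - a) ≤ C * (1 + |y - a| ^ (-s)) - c * Real.log (1 + |a|)

theorem log_one_add_abs_nonneg (u : ℝ) : 0 ≤ Real.log (1 + |u|) :=
  Real.log_nonneg (by linarith [abs_nonneg u])

theorem log_one_add_abs_add_le (u v : ℝ) :
    Real.log (1 + |u + v|) ≤ Real.log (1 + |u|) + Real.log (1 + |v|) := by
  rw [← Real.log_mul (by positivity) (by positivity)]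
  apply Real.log_le_log (by positivity)
  nlinarith [abs_add_le u v, abs_nonneg u, abs_nonneg v]

theorem isTameInteraction_rieszInteraction (s : ℝ) :
    IsTameInteraction (rieszInteraction s) s 0 1 where
  measurable := by unfold rieszInteraction; fun_prop
  even u := by simp [rieszInteraction]
  neg_le u := by
    have : 0 ≤ |u| ^ (-s) := by positivity
    simp only [rieszInteraction]; linarith
  le_singular y _ a := by simp only [rieszInteraction]; linarith

theorem isTameInteraction_logInteraction :
    IsTameInteraction logInteraction (1 / 2) 1 4 where
  measurable := by unfold logInteraction; fun_prop
  even u := by simp [logInteraction]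
  neg_le u := by
    simp only [logInteraction, neg_neg, one_mul]
    rcases eq_or_ne u 0 with rfl | hu
    · simp
    · exact Real.log_le_log (abs_pos.2 hu) (by linarith)
  le_singular y hy a := by
    simp only [logInteraction]
    rcases eq_or_ne y a with rfl | h
    -- At coincident points both `log 0` and `0 ^ (-1/2)` take the value `0`.
    · have h1 : Real.log (1 + |y|) ≤ 1 := by
        have := Real.log_le_sub_one_of_pos (show 0 < 1 + |y| by positivity)
        have h2 : |y| ≤ 1 := by rw [abs_of_nonneg hy.1]; exact hy.2
        linarith
      have h2 : (0 : ℝ) ^ (-(1 / 2) : ℝ) = 0 := Real.zero_rpow (by norm_num)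
      simp at *
      linarith
    -- With `w = u^{-1/2}`, `1 + |a| ≤ 2 + u ≤ u (1 + 2 w)²`, and `log (1 + 2 w) ≤ 2 w`.
    · have hu : 0 < |y - a| := abs_pos.2 (sub_ne_zero.2 h)
      set u := |y - a|
      set w := u ^ (-(1 / 2) : ℝ) with hw
      have hw0 : 0 < w := by positivity
      have hww : w ^ 2 = u⁻¹ := by
        rw [hw, ← Real.rpow_natCast, ← Real.rpow_mul hu.le, ← Real.rpow_neg_one]; norm_num
      have ha : 1 + |a| ≤ 2 + u := by
        have := abs_sub_abs_le_abs_sub a y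
        rw [abs_sub_comm, abs_of_nonneg hy.1] at this
        linarith [hy.2]
      have h1 : 1 + |a| ≤ u * (1 + 2 * w) ^ 2 := by
        have : u * w ^ 2 = 1 := by rw [hww]; field_simp
        nlinarith [mul_pos hu hw0]
      have h2 : Real.log (1 + |a|) ≤ Real.log u + 2 * Real.log (1 + 2 * w) := by
        have := Real.log_le_log (by positivity) h1
        rwa [Real.log_mul hu.ne' (by positivity), Real.log_pow] at this
      have h3 := Real.log_le_sub_one_of_pos (show 0 < 1 + 2 * w by positivity)
      linarith

/-- The singularity `|u|^{-s}` with `s < 1` is integrable, uniformly over translations. -/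
theorem exists_lintegral_abs_sub_rpow_neg_le {s : ℝ} (hs0 : 0 < s) (hs1 : s < 1) :
    ∃ K : ℝ, 1 ≤ K ∧ ∀ T a : ℝ,
      ∫⁻ y in Set.Icc T (T + 1), ENNReal.ofReal (|y - a| ^ (-s)) ≤ ENNReal.ofReal K := by
  -- `|u|^{-s}` is at most `1` off `[-1, 1]`, so only its integral over `[-1, 1]` matters.
  set F : ℝ → ENNReal := (Set.Icc (-1 : ℝ) 1).indicator fun u => ENNReal.ofReal (|u| ^ (-s))
    with hF
  have hi : IntegrableOn (fun u : ℝ => |u| ^ (-s)) (Set.Icc (-1) 1) := by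
    have h1 : IntegrableOn (fun u : ℝ => |u| ^ (-s)) (Set.Icc 0 1) := by
      have := (intervalIntegral.intervalIntegrable_rpow' (a := 0) (b := 1)
        (show -1 < -s by linarith))
      rw [intervalIntegrable_iff_integrableOn_Icc_of_le zero_le_one] at this
      refine this.congr_fun (fun u hu => ?_) measurableSet_Icc
      simp only [abs_of_nonneg hu.1]
    have h2 : IntegrableOn (fun u : ℝ => |u| ^ (-s)) (Set.Icc (-1) 0) := by
      have := h1.comp_neg
      simpa using this
    have := h2.union h1
    rwa [Set.Icc_union_Icc_eq_Icc (by norm_num) (by norm_num)] at this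
  have hfin : ∫⁻ u, F u ≠ ⊤ := by
    rw [hF, lintegral_indicator measurableSet_Icc]
    exact hi.lintegral_lt_top.ne
  refine ⟨1 + (∫⁻ u, F u).toReal, by linarith [ENNReal.toReal_nonneg (a := ∫⁻ u, F u)],
    fun T a => ?_⟩
  calc ∫⁻ y in Set.Icc T (T + 1), ENNReal.ofReal (|y - a| ^ (-s))
      ≤ ∫⁻ y in Set.Icc T (T + 1), (1 + F (y - a)) := by
        apply lintegral_mono
        intro y
        simp only [hF, Set.indicator]
        split_ifs with h
        · exact le_add_self
        · rw [add_zero, ENNReal.ofReal_le_one]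
          apply Real.rpow_le_one_of_one_le_of_nonpos _ (by linarith)
          by_contra! h'
          exact h (abs_le.1 h'.le)
    _ = 1 + ∫⁻ y in Set.Icc T (T + 1), F (y - a) := by
        rw [lintegral_add_left measurable_const]; simp
    _ ≤ 1 + ∫⁻ y, F (y - a) := by gcongr; exact Measure.restrict_le_self
    _ = 1 + ∫⁻ u, F u := by rw [lintegral_sub_right_eq_self]
    _ = _ := by
        rw [ENNReal.ofReal_add zero_le_one ENNReal.toReal_nonneg, ENNReal.ofReal_toReal hfin,
          ENNReal.ofReal_one]

/-- Markov's inequality: on at least half of a unit interval the total singularity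
`∑ |y - a_j|^{-s}` of finitely many particles is at most proportional to their number. -/
theorem half_le_volume_sum_abs_sub_rpow_neg_le {s K : ℝ} (hK : 1 ≤ K)
    (h : ∀ T a : ℝ,
      ∫⁻ y in Set.Icc T (T + 1), ENNReal.ofReal (|y - a| ^ (-s)) ≤ ENNReal.ofReal K)
    {ι : Type*} (S : Finset ι) (a : ι → ℝ) (T : ℝ) :
    2⁻¹ ≤ volume (Set.Icc T (T + 1) ∩
      {y | ∑ j ∈ S, |y - a j| ^ (-s) ≤ 2 * K * (S.card + 1)}) := by
  set A : ℝ := 2 * K * (S.card + 1) with hA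
  have hA0 : 0 < A := by positivity
  set μ := (volume : Measure ℝ).restrict (Set.Icc T (T + 1)) with hμ
  have hm : Measurable fun y => ∑ j ∈ S, |y - a j| ^ (-s) := by fun_prop
  have hprob : μ Set.univ = 1 := by simp [hμ]
  have hbad : μ {y | ∑ j ∈ S, |y - a j| ^ (-s) ≤ A}ᶜ ≤ 2⁻¹ := by
    have h1 : ∫⁻ y, ENNReal.ofReal (∑ j ∈ S, |y - a j| ^ (-s)) ∂μ
        ≤ ENNReal.ofReal (S.card * K) := by
      calc _ = ∫⁻ y, ∑ j ∈ S, ENNReal.ofReal (|y - a j| ^ (-s)) ∂μ := by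
            congr 1; ext y; exact ENNReal.ofReal_sum_of_nonneg fun j _ => by positivity
        _ = ∑ j ∈ S, ∫⁻ y, ENNReal.ofReal (|y - a j| ^ (-s)) ∂μ :=
            lintegral_finsetSum _ fun j _ => by fun_prop
        _ ≤ ∑ j ∈ S, ENNReal.ofReal K := Finset.sum_le_sum fun j _ => h T (a j)
        _ = _ := by
            rw [Finset.sum_const, nsmul_eq_mul, ENNReal.ofReal_mul (by positivity),
              ENNReal.ofReal_natCast]
    have h2 := mul_meas_ge_le_lintegral (μ := μ) hm.ennreal_ofReal (ENNReal.ofReal A)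
    have h3 : μ {y | ∑ j ∈ S, |y - a j| ^ (-s) ≤ A}ᶜ ≤
        μ {y | ENNReal.ofReal A ≤ ENNReal.ofReal (∑ j ∈ S, |y - a j| ^ (-s))} := by
      apply measure_mono
      intro y hy
      simp only [Set.mem_compl_iff, Set.mem_ofPred_eq, not_le] at hy ⊢
      exact ENNReal.ofReal_le_ofReal hy.le
    refine h3.trans ?_
    rw [← ENNReal.mul_le_mul_iff_right (a := ENNReal.ofReal A) (by simpa using hA0)
      ENNReal.ofReal_ne_top]
    refine h2.trans (h1.trans ?_)
    rw [show (2 : ENNReal)⁻¹ = ENNReal.ofReal 2⁻¹ by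
      rw [ENNReal.ofReal_inv_of_pos two_pos]; simp, ← ENNReal.ofReal_mul hA0.le]
    apply ENNReal.ofReal_le_ofReal
    rw [hA]; nlinarith
  have hms : MeasurableSet {y | ∑ j ∈ S, |y - a j| ^ (-s) ≤ A} :=
    measurableSet_le hm measurable_const
  rw [Set.inter_comm, ← Measure.restrict_apply hms]
  have h4 := measure_add_measure_compl (μ := μ) hms
  rw [hprob, ← ENNReal.inv_two_add_inv_two] at h4
  by_contra! h5
  exact absurd h4 (ENNReal.add_lt_add_of_lt_of_le (by
    exact ne_top_of_le_ne_top (by simp) hbad) h5 hbad).ne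

/-- The conditional mass of one particle above the level `T`, given the others at `a_j`, is
bounded below by its total conditional mass, uniformly in the positions of the others: both
masses carry the same factor `∏ (1 + |a_j - T|) ^ (c β)`. -/
theorem ofReal_mul_lintegral_le_setLIntegral_Ici {g V : ℝ → ℝ} {s c C K B β T v ε : ℝ}
    (hg : IsTameInteraction g s c C) (hC : 0 ≤ C) (hc : 0 ≤ c)
    (hβ : 0 ≤ β) (hK : 1 ≤ K) (hT : 0 ≤ T)
    (h : ∀ T a : ℝ,
      ∫⁻ y in Set.Icc T (T + 1), ENNReal.ofReal (|y - a| ^ (-s)) ≤ ENNReal.ofReal K)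
    (hJ : ∫⁻ y, ENNReal.ofReal (Real.exp (-V y + c * B * Real.log (1 + |y|))) ≠ ⊤)
    (hv : ∀ y ∈ Set.Icc T (T + 1), V y ≤ v)
    {ι : Type*} (S : Finset ι) (hS : β * (S.card + 1) ≤ B) (a : ι → ℝ)
    (hε0 : 0 ≤ ε)
    (hε : ε * (∫⁻ y, ENNReal.ofReal (Real.exp (-V y + c * B * Real.log (1 + |y|)))).toReal ≤
      2⁻¹ * Real.exp (-v - C * B * (1 + 2 * K) - c * B * Real.log (1 + T))) :
    ENNReal.ofReal ε *
        ∫⁻ y, ENNReal.ofReal (Real.exp (-V y - β * ∑ j ∈ S, g (y - a j))) ≤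
      ∫⁻ y in Set.Ici T, ENNReal.ofReal (Real.exp (-V y - β * ∑ j ∈ S, g (y - a j))) := by
  set J := ∫⁻ y, ENNReal.ofReal (Real.exp (-V y + c * B * Real.log (1 + |y|)))
  set D := c * β * ∑ j ∈ S, Real.log (1 + |a j - T|) with hD
  have hβS : β * S.card ≤ B := by linarith
  have hB : 0 ≤ B := le_trans (by positivity) hS
  have hT' : |T| = T := abs_of_nonneg hT
  have up : ∫⁻ y, ENNReal.ofReal (Real.exp (-V y - β * ∑ j ∈ S, g (y - a j))) ≤
      ENNReal.ofReal (Real.exp (D + c * B * Real.log (1 + T))) * J := by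
    rw [← lintegral_const_mul' _ _ ENNReal.ofReal_ne_top]
    apply lintegral_mono
    intro y
    dsimp only
    rw [← ENNReal.ofReal_mul (Real.exp_pos _).le, ← Real.exp_add]
    apply ENNReal.ofReal_le_ofReal
    apply Real.exp_le_exp.2
    have h1 : -∑ j ∈ S, g (y - a j) ≤ c * ∑ j ∈ S, Real.log (1 + |a j - T|) +
        S.card * (c * (Real.log (1 + |y|) + Real.log (1 + T))) := by
      rw [← Finset.sum_neg_distrib, Finset.mul_sum, ← nsmul_eq_mul, ← Finset.sum_const,
        ← Finset.sum_add_distrib]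
      refine Finset.sum_le_sum fun j _ => (hg.neg_le _).trans ?_
      rw [← mul_add]
      apply mul_le_mul_of_nonneg_left _ hc
      have e1 := log_one_add_abs_add_le (y - T) (-(a j - T))
      have e2 := log_one_add_abs_add_le y (-T)
      rw [abs_neg, ← sub_eq_add_neg] at e1 e2
      rw [hT'] at e2
      rw [show y - T - (a j - T) = y - a j by ring] at e1
      linarith
    have h2 := mul_le_mul_of_nonneg_left h1 hβ
    have h3 : β * S.card * (c * (Real.log (1 + |y|) + Real.log (1 + T))) ≤
        B * (c * (Real.log (1 + |y|) + Real.log (1 + T))) := by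
      apply mul_le_mul_of_nonneg_right hβS
      have := log_one_add_abs_nonneg y
      have := log_one_add_abs_nonneg T
      rw [hT'] at this
      positivity
    rw [hD]
    linarith
  have lo : ENNReal.ofReal (2⁻¹ * Real.exp (-v - C * B * (1 + 2 * K) + D)) ≤
      ∫⁻ y in Set.Ici T, ENNReal.ofReal (Real.exp (-V y - β * ∑ j ∈ S, g (y - a j))) := by
    set G := Set.Icc T (T + 1) ∩ {y | ∑ j ∈ S, |y - a j| ^ (-s) ≤ 2 * K * (S.card + 1)} with hG
    have hGm : MeasurableSet G := by
      apply measurableSet_Icc.inter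
      exact measurableSet_le (by fun_prop) measurable_const
    calc ENNReal.ofReal (2⁻¹ * Real.exp (-v - C * B * (1 + 2 * K) + D))
        = ENNReal.ofReal (Real.exp (-v - C * B * (1 + 2 * K) + D)) * 2⁻¹ := by
          rw [mul_comm, ENNReal.ofReal_mul (Real.exp_pos _).le,
            ENNReal.ofReal_inv_of_pos two_pos]
          simp
      _ ≤ ENNReal.ofReal (Real.exp (-v - C * B * (1 + 2 * K) + D)) * volume G := by
          gcongr
          exact half_le_volume_sum_abs_sub_rpow_neg_le hK h S a T
      _ = ∫⁻ y in G, ENNReal.ofReal (Real.exp (-v - C * B * (1 + 2 * K) + D)) := by simp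
      _ ≤ ∫⁻ y in G, ENNReal.ofReal (Real.exp (-V y - β * ∑ j ∈ S, g (y - a j))) := by
          apply setLIntegral_mono' hGm
          intro y hy
          apply ENNReal.ofReal_le_ofReal
          apply Real.exp_le_exp.2
          have h1 : ∑ j ∈ S, g (y - a j) ≤ C * (S.card + ∑ j ∈ S, |y - a j| ^ (-s)) -
              c * ∑ j ∈ S, Real.log (1 + |a j - T|) := by
            rw [Finset.card_eq_sum_ones, Nat.cast_sum, ← Finset.sum_add_distrib,
              Finset.mul_sum, Finset.mul_sum, ← Finset.sum_sub_distrib]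
            refine Finset.sum_le_sum fun j _ => ?_
            have := hg.le_singular (y - T) ⟨by linarith [hy.1.1], by linarith [hy.1.2]⟩ (a j - T)
            rw [show y - T - (a j - T) = y - a j by ring] at this
            simpa using this
          have h2 : C * (S.card + ∑ j ∈ S, |y - a j| ^ (-s)) ≤
              C * ((1 + 2 * K) * (S.card + 1)) := by
            apply mul_le_mul_of_nonneg_left _ hC
            have := hy.2
            simp only [Set.mem_ofPred_eq] at this
            linarith
          have h3 := mul_le_mul_of_nonneg_left (h1.trans (sub_le_sub_right h2 _)) hβ
          have h4 : C * (1 + 2 * K) * (β * (S.card + 1)) ≤ C * (1 + 2 * K) * B :=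
            mul_le_mul_of_nonneg_left hS (by positivity)
          have h5 := hv y hy.1
          rw [hD]
          linarith
      _ ≤ _ := lintegral_mono_set fun y hy => hy.1.1
  refine le_trans ?_ lo
  calc _ ≤ ENNReal.ofReal ε * (ENNReal.ofReal (Real.exp (D + c * B * Real.log (1 + T))) * J) := by
        gcongr
    _ = ENNReal.ofReal (Real.exp (D + c * B * Real.log (1 + T)) * (ε * J.toReal)) := by
        rw [← ENNReal.ofReal_toReal hJ, ← ENNReal.ofReal_mul (Real.exp_pos _).le,
          ← ENNReal.ofReal_mul hε0, ENNReal.toReal_ofReal ENNReal.toReal_nonneg]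
        congr 1; ring
    _ ≤ _ := by
        apply ENNReal.ofReal_le_ofReal
        refine (mul_le_mul_of_nonneg_left hε (Real.exp_pos _).le).trans (le_of_eq ?_)
        rw [mul_left_comm, ← Real.exp_add]
        congr 2; ring

/-! ### The confining potential -/

theorem PotentialAssumptions.measurable_potential {κ α : ℝ} {φ : ℝ → ℝ}
    (hV : PotentialAssumptions κ α φ) : Measurable (potential κ α φ) := by
  have := hV.measurable
  unfold potential
  fun_prop

theorem PotentialAssumptions.exists_linear_le_potential {κ α : ℝ} {φ : ℝ → ℝ}
    (hV : PotentialAssumptions κ α φ) :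
    ∃ b C₀ : ℝ, 0 < b ∧ ∀ y, b * |y| - C₀ ≤ potential κ α φ y := by
  have hκ := hV.kappa_pos
  obtain ⟨K, hK, hKs⟩ := mem_cocompact.1 (hV.isLittleO.def (half_pos hκ))
  obtain ⟨m, hm⟩ := hV.locally_bddBelow K hK
  refine ⟨κ / 2, κ / 2 + |m|, half_pos hκ, fun y => ?_⟩
  have h0 : 0 ≤ |y| ^ α := by positivity
  have h1 : |y| - 1 ≤ |y| ^ α := by
    rcases le_total |y| 1 with h | h
    · linarith
    · have := Real.rpow_le_rpow_of_exponent_le h hV.one_le_alpha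
      rw [Real.rpow_one] at this
      linarith
  have h2 : -|m| - κ / 2 * |y| ^ α ≤ φ y := by
    by_cases hy : y ∈ K
    · have := hm ⟨y, hy, rfl⟩
      have := neg_abs_le m
      have := mul_nonneg (half_pos hκ).le h0
      linarith
    · have := hKs hy
      simp only [Set.mem_ofPred_eq, Real.norm_eq_abs, abs_of_nonneg h0] at this
      have := (abs_le.1 this).1
      have := abs_nonneg m
      linarith
  have h3 := mul_le_mul_of_nonneg_left h1 (half_pos hκ).le
  unfold potential
  linarith

/-- All polynomial moments of the weight `e^{-V}` are finite. -/
theorem PotentialAssumptions.integrable_exp_neg_potential {κ α : ℝ} {φ : ℝ → ℝ}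
    (hV : PotentialAssumptions κ α φ) (m : ℝ) :
    Integrable fun y => Real.exp (-potential κ α φ y + m * Real.log (1 + |y|)) := by
  obtain ⟨b, C₀, hb, hlin⟩ := hV.exists_linear_le_potential
  set n : ℕ := ⌈m⌉₊ + 2 with hn
  refine (integrable_inv_one_add_sq.const_mul
    (Real.exp (C₀ + b) * (n.factorial / b ^ n))).mono' ?_ (Eventually.of_forall fun y => ?_)
  · have := hV.measurable_potential
    exact Measurable.aestronglyMeasurable (by fun_prop)
  · rw [Real.norm_of_nonneg (Real.exp_pos _).le]
    set z := 1 + |y| with hz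
    have hz1 : 1 ≤ z := by linarith [abs_nonneg y]
    have hz0 : 0 < z := by linarith
    have h1 : Real.exp (m * Real.log z) * z ^ 2 ≤ z ^ n := by
      rw [hn, pow_add]
      apply mul_le_mul_of_nonneg_right _ (by positivity)
      rw [← Real.exp_log hz0, ← Real.exp_nat_mul, Real.log_exp]
      exact Real.exp_le_exp.2 (mul_le_mul_of_nonneg_right (Nat.le_ceil m) (Real.log_nonneg hz1))
    have h2 : z ^ n ≤ n.factorial / b ^ n * Real.exp (b * z) := by
      have := Real.pow_div_factorial_le_exp (b * z) (by positivity) n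
      rw [div_le_iff₀ (by positivity), mul_pow] at this
      rw [div_mul_eq_mul_div, le_div_iff₀ (by positivity)]
      linarith
    have h3 : (z ^ 2)⁻¹ ≤ (1 + y ^ 2)⁻¹ := by
      apply inv_anti₀ (by positivity)
      rw [← sq_abs y]
      nlinarith [abs_nonneg y]
    have h4 : -potential κ α φ y ≤ C₀ + b - b * z := by
      have := hlin y
      rw [hz]; linarith
    rw [Real.exp_add]
    calc _ ≤ Real.exp (C₀ + b - b * z) * (n.factorial / b ^ n * Real.exp (b * z) * (z ^ 2)⁻¹) := by
          apply mul_le_mul (Real.exp_le_exp.2 h4) _ (Real.exp_pos _).le (Real.exp_pos _).le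
          rw [← div_eq_mul_inv, le_div_iff₀ (by positivity)]
          exact h1.trans h2
      _ = Real.exp (C₀ + b) * (n.factorial / b ^ n) * (z ^ 2)⁻¹ := by
          rw [Real.exp_sub]; field_simp
      _ ≤ _ := by gcongr

theorem PotentialAssumptions.eventually_potential_le {κ α : ℝ} {φ : ℝ → ℝ}
    (hV : PotentialAssumptions κ α φ) {δ : ℝ} (hδ : 0 < δ) :
    ∀ᶠ T in atTop, ∀ y ∈ Set.Icc T (T + 1), potential κ α φ y ≤ (κ + δ) * T ^ α := by
  have hκ := hV.kappa_pos
  have hα := hV.one_le_alpha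
  have h1 : ∀ᶠ y in atTop, ‖φ y‖ ≤ δ / 2 * ‖|y| ^ α‖ :=
    atTop_le_cocompact (hV.isLittleO.def (half_pos hδ))
  have h2 : Tendsto (fun T : ℝ => (κ + δ / 2) * ((1 + T⁻¹) ^ α)) atTop (𝓝 (κ + δ / 2)) := by
    have := ((tendsto_inv_atTop_zero (𝕜 := ℝ)).const_add 1).rpow_const (p := α)
      (Or.inl (by norm_num))
    simpa using this.const_mul (κ + δ / 2)
  filter_upwards [eventually_forall_ge_atTop.2 h1,
    h2.eventually_le_const (show κ + δ / 2 < κ + δ by linarith), eventually_gt_atTop 0] with T hT1 hT2 hT0 y hy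
  have hy0 : 0 < y := hT0.trans_le hy.1
  have e1 := hT1 y hy.1
  rw [Real.norm_eq_abs, Real.norm_eq_abs, abs_of_nonneg (by positivity : 0 ≤ |y| ^ α),
    abs_of_pos hy0] at e1
  have e2 := (le_abs_self _).trans e1
  have e3 : y ^ α ≤ T ^ α * (1 + T⁻¹) ^ α := by
    rw [← Real.mul_rpow hT0.le (by positivity)]
    apply Real.rpow_le_rpow hy0.le _ (by linarith)
    rw [mul_add, mul_inv_cancel₀ hT0.ne']
    linarith [hy.2]
  have e4 := mul_le_mul_of_nonneg_left e3 (show 0 ≤ κ + δ / 2 by linarith)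
  have e5 := mul_le_mul_of_nonneg_right hT2 (show 0 ≤ T ^ α by positivity)
  unfold potential
  rw [abs_of_pos hy0]
  linarith

theorem eventually_add_mul_log_le_mul_rpow {α : ℝ} (hα : 1 ≤ α) (A m : ℝ) {δ : ℝ} (hδ : 0 < δ) :
    ∀ᶠ T : ℝ in atTop, A + m * Real.log (1 + T) ≤ δ * T ^ α := by
  have h1 : (fun T : ℝ => A + m * Real.log (1 + T)) =o[atTop] fun T : ℝ => 1 + T := by
    have ht : Tendsto (fun T : ℝ => 1 + T) atTop atTop :=
      tendsto_atTop_add_const_left _ _ tendsto_id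
    refine ((isLittleO_const_id_atTop A).comp_tendsto ht).add ?_
    exact (Real.isLittleO_log_id_atTop.comp_tendsto ht).const_mul_left m
  filter_upwards [h1.def (half_pos hδ), eventually_ge_atTop 1] with T hT hT1
  have h2 := Real.rpow_le_rpow_of_exponent_le hT1 hα
  rw [Real.rpow_one] at h2
  rw [Real.norm_eq_abs, Real.norm_eq_abs, abs_of_pos (show 0 < 1 + T by linarith)] at hT
  have h3 := (le_abs_self _).trans hT
  have h4 := mul_le_mul_of_nonneg_left (show 1 + T ≤ 2 * T ^ α by linarith) (half_pos hδ).le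
  linarith

/-! ### The Gibbs weight -/

theorem gibbsWeight_eq_exp (g V : ℝ → ℝ) (β : ℝ) (N : ℕ) (x : Fin N → ℝ) :
    gibbsWeight g V β N x =
      Real.exp (-β * ∑ i, ∑ j ∈ Finset.Ioi i, g (x i - x j) - ∑ i, V (x i)) := by
  rw [gibbsWeight, sub_eq_add_neg, Real.exp_add, ← Finset.sum_neg_distrib, Real.exp_sum,
    Finset.mul_sum, Real.exp_sum]
  simp_rw [Finset.mul_sum, Real.exp_sum]

theorem measurable_gibbsWeight {g V : ℝ → ℝ} (hg : Measurable g) (hV : Measurable V) (β : ℝ)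
    (N : ℕ) : Measurable (gibbsWeight g V β N) := by
  unfold gibbsWeight
  fun_prop

/-- In a symmetric sum over pairs, the pairs containing a given index `i` can be split off. -/
theorem sum_sum_Ioi_eq_add_sum_erase {N : ℕ} (H : Fin N → Fin N → ℝ) (hH : ∀ k l, H k l = H l k)
    (i : Fin N) :
    ∑ k, ∑ l ∈ Finset.Ioi k, H k l =
      ∑ k ∈ Finset.univ.erase i, ∑ l ∈ (Finset.Ioi k).erase i, H k l +
        ∑ j ∈ Finset.univ.erase i, H i j := by
  have h1 : ∀ k ∈ Finset.univ.erase i, ∑ l ∈ Finset.Ioi k, H k l =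
      ∑ l ∈ (Finset.Ioi k).erase i, H k l + if k < i then H i k else 0 := by
    intro k _
    split_ifs with h
    · rw [hH i k, Finset.sum_erase_add _ _ (Finset.mem_Ioi.2 h)]
    · rw [Finset.erase_eq_of_notMem (by simpa using h), add_zero]
  rw [← Finset.sum_erase_add _ _ (Finset.mem_univ i), Finset.sum_congr rfl h1,
    Finset.sum_add_distrib, add_assoc]
  congr 1
  have h2 : ∑ l ∈ Finset.Ioi i, H i l = ∑ k ∈ Finset.univ.erase i, if i < k then H i k else 0 := by
    rw [← Finset.sum_filter]
    congr 1
    ext k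
    simp only [Finset.mem_Ioi, Finset.mem_filter, Finset.mem_erase, Finset.mem_univ, and_true]
    exact ⟨fun h => ⟨h.ne', h⟩, fun h => h.2⟩
  rw [h2, ← Finset.sum_add_distrib]
  refine Finset.sum_congr rfl fun k hk => ?_
  rcases lt_or_gt_of_ne (Finset.ne_of_mem_erase hk) with h | h
  · simp [h, h.not_gt]
  · simp [h, h.not_gt]

/-- As a function of a single particle the Gibbs weight is proportional to `e^{-V(y)}` times the
interaction with the other particles. -/
theorem exists_gibbsWeight_update_eq {g V : ℝ → ℝ} (hg : ∀ u, g (-u) = g u) (β : ℝ) (N : ℕ)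
    (x : Fin N → ℝ) (i : Fin N) :
    ∃ D : ℝ, 0 ≤ D ∧ ∀ y, gibbsWeight g V β N (Function.update x i y) =
      D * Real.exp (-V y - β * ∑ j ∈ Finset.univ.erase i, g (y - x j)) := by
  refine ⟨Real.exp (-β * ∑ k ∈ Finset.univ.erase i, ∑ l ∈ (Finset.Ioi k).erase i, g (x k - x l) -
    ∑ k ∈ Finset.univ.erase i, V (x k)), (Real.exp_pos _).le, fun y => ?_⟩
  rw [gibbsWeight_eq_exp, ← Real.exp_add,
    sum_sum_Ioi_eq_add_sum_erase (fun k l => g (Function.update x i y k - Function.update x i y l))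
      (fun k l => by rw [← hg, neg_sub]) i,
    ← Finset.sum_erase_add _ _ (Finset.mem_univ i)]
  have e1 : ∀ k ∈ Finset.univ.erase i, ∀ l ∈ (Finset.Ioi k).erase i,
      g (Function.update x i y k - Function.update x i y l) = g (x k - x l) := fun k hk l hl => by
    rw [Function.update_of_ne (Finset.ne_of_mem_erase hk),
      Function.update_of_ne (Finset.ne_of_mem_erase hl)]
  have e2 : ∀ j ∈ Finset.univ.erase i,
      g (Function.update x i y i - Function.update x i y j) = g (y - x j) := fun j hj => by
    rw [Function.update_of_ne (Finset.ne_of_mem_erase hj), Function.update_self]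
  have e3 : ∀ j ∈ Finset.univ.erase i, V (Function.update x i y j) = V (x j) := fun j hj => by
    rw [Function.update_of_ne (Finset.ne_of_mem_erase hj)]
  rw [Finset.sum_congr rfl fun k hk => Finset.sum_congr rfl (e1 k hk), Finset.sum_congr rfl e2,
    Finset.sum_congr rfl e3, Function.update_self]
  congr 1
  ring

/-- The normalization is finite: each pair contributes at most a power of
`(1 + |x i|) (1 + |x j|)`, so the weight is dominated by a product of integrable one-particle
factors. -/
theorem partitionFunction_ne_top {κ α : ℝ} {φ : ℝ → ℝ} (hV : PotentialAssumptions κ α φ)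
    {g : ℝ → ℝ} {s c C : ℝ} (hg : IsTameInteraction g s c C) (hc : 0 ≤ c) {β : ℝ} (hβ : 0 ≤ β)
    (N : ℕ) : partitionFunction g (potential κ α φ) β N ≠ ⊤ := by
  set V := potential κ α φ
  have hi : Integrable fun x : Fin N → ℝ =>
      ∏ i, Real.exp (-V (x i) + β * c * (2 * N) * Real.log (1 + |x i|)) :=
    Integrable.fintype_prod fun _ => hV.integrable_exp_neg_potential _
  refine ne_top_of_le_ne_top hi.lintegral_lt_top.ne (lintegral_mono fun x => ?_)
  apply ENNReal.ofReal_le_ofReal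
  rw [gibbsWeight_eq_exp, ← Real.exp_sum, Finset.sum_add_distrib, Finset.sum_neg_distrib,
    ← Finset.mul_sum]
  apply Real.exp_le_exp.2
  have h1 : -∑ i, ∑ j ∈ Finset.Ioi i, g (x i - x j) ≤
      c * (2 * N * ∑ i, Real.log (1 + |x i|)) := by
    calc -∑ i, ∑ j ∈ Finset.Ioi i, g (x i - x j)
        = ∑ i, ∑ j ∈ Finset.Ioi i, -g (x i - x j) := by simp
      _ ≤ ∑ i, ∑ j ∈ Finset.Ioi i, c * (Real.log (1 + |x i|) + Real.log (1 + |x j|)) := by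
          refine Finset.sum_le_sum fun i _ => Finset.sum_le_sum fun j _ => (hg.neg_le _).trans ?_
          have := log_one_add_abs_add_le (x i) (-x j)
          rw [abs_neg, ← sub_eq_add_neg] at this
          exact mul_le_mul_of_nonneg_left this hc
      _ ≤ ∑ i, ∑ j, c * (Real.log (1 + |x i|) + Real.log (1 + |x j|)) := by
          refine Finset.sum_le_sum fun i _ => Finset.sum_le_sum_of_subset_of_nonneg
            (Finset.subset_univ _) fun j _ _ => mul_nonneg hc (add_nonneg ?_ ?_)
          · exact log_one_add_abs_nonneg _
          · exact log_one_add_abs_nonneg _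
      _ = _ := by
          simp only [← Finset.mul_sum, Finset.sum_add_distrib, Finset.sum_const, Finset.card_univ,
            Fintype.card_fin, nsmul_eq_mul]
          ring
  have h2 := mul_le_mul_of_nonneg_left h1 hβ
  linarith

/-! ### Confining the particles one at a time -/

/-- If each coordinate, conditionally on all the others, exceeds `T` with probability at least `ε`,
then all the coordinates in `S` stay below `T` with probability at most `(1 - ε) ^ #S`. -/
theorem setLIntegral_forall_lt_le {N : ℕ} {w : (Fin N → ℝ) → ENNReal} (hw : Measurable w)
    {ε T : ℝ} (hε0 : 0 ≤ ε) (hε1 : ε < 1)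
    (h : ∀ (i : Fin N) (x : Fin N → ℝ), ENNReal.ofReal ε * ∫⁻ y, w (Function.update x i y) ≤
      ∫⁻ y in Set.Ici T, w (Function.update x i y)) (S : Finset (Fin N)) :
    ∫⁻ x in {x | ∀ i ∈ S, x i < T}, w x ≤ ENNReal.ofReal (1 - ε) ^ S.card * ∫⁻ x, w x := by
  have hm : ∀ S : Finset (Fin N), MeasurableSet {x : Fin N → ℝ | ∀ i ∈ S, x i < T} := fun S => by
    have : {x : Fin N → ℝ | ∀ i ∈ S, x i < T} = ⋂ i ∈ S, {x | x i < T} := by ext; simp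
    rw [this]
    exact Finset.measurableSet_biInter _ fun i _ =>
      measurableSet_lt (measurable_pi_apply i) measurable_const
  induction S using Finset.induction_on with
  | empty => simp
  | insert i S hi ih =>
    rw [Finset.card_insert_of_notMem hi, pow_succ', mul_assoc]
    refine le_trans ?_ (mul_le_mul_right ih _)
    rw [← lintegral_indicator (hm _), ← lintegral_indicator (hm _),
      ← lintegral_const_mul _ (hw.indicator (hm _))]
    refine lintegral_le_of_lmarginal_le {i} (hw.indicator (hm _))
      ((hw.indicator (hm _)).const_mul _) ?_
    rw [lmarginal_singleton, lmarginal_singleton]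
    intro x
    dsimp only
    have hwi : Measurable fun y => w (Function.update x i y) := hw.comp (measurable_update x)
    have hS : ∀ y, (Function.update x i y ∈ {x : Fin N → ℝ | ∀ i ∈ S, x i < T} ↔
        ∀ j ∈ S, x j < T) := fun y => by
      refine forall₂_congr fun j hj => ?_
      rw [Function.update_of_ne (ne_of_mem_of_not_mem hj hi)]
    by_cases hx : ∀ j ∈ S, x j < T
    · have e1 : ∀ y, {x : Fin N → ℝ | ∀ k ∈ insert i S, x k < T}.indicator w
          (Function.update x i y) = (Set.Iio T).indicator
            (fun y => w (Function.update x i y)) y := fun y => by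
        have := (hS y).2 hx
        simp only [Set.mem_ofPred_eq] at this
        simp only [Set.indicator, Set.mem_ofPred_eq, Finset.forall_mem_insert,
          Function.update_self, Set.mem_Iio, and_iff_left this]
      have e2 : ∀ y, {x : Fin N → ℝ | ∀ i ∈ S, x i < T}.indicator w (Function.update x i y) =
          w (Function.update x i y) := fun y => Set.indicator_of_mem ((hS y).2 hx) _
      simp_rw [e1, e2]
      rw [lintegral_indicator measurableSet_Iio, lintegral_const_mul _ hwi]
      have hadd := lintegral_add_compl (μ := volume) (fun y => w (Function.update x i y))
        (measurableSet_Iio (a := T))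
      rw [Set.compl_Iio] at hadd
      set I := ∫⁻ y, w (Function.update x i y)
      -- Subtracting the mass above `T` requires a finite total; otherwise the bound is trivial.
      rcases eq_or_ne I ⊤ with hI | hI
      · rw [hI, ENNReal.mul_top (by simpa using hε1)]
        exact le_top
      · have hh := h i x
        have hfin : ENNReal.ofReal ε * I ≠ ⊤ := ENNReal.mul_ne_top ENNReal.ofReal_ne_top hI
        rw [← ENNReal.add_le_add_iff_right hfin, ← add_mul,
          ← ENNReal.ofReal_add (by linarith) hε0, sub_add_cancel, ENNReal.ofReal_one, one_mul]
        calc _ ≤ _ := add_le_add_right hh _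
          _ = I := hadd
    · have e1 : ∀ y, {x : Fin N → ℝ | ∀ k ∈ insert i S, x k < T}.indicator w
          (Function.update x i y) = 0 := fun y => by
        apply Set.indicator_of_notMem
        intro hy
        exact hx ((hS y).1 fun j hj => hy j (Finset.mem_insert_of_mem hj))
      simp_rw [e1]
      simp

/-! ### The left deviation probability -/

theorem gibbsMeasure_real_apply (g V : ℝ → ℝ) (β : ℝ) (N : ℕ) {A : Set (Fin N → ℝ)}
    (hA : MeasurableSet A) :
    (gibbsMeasure g V β N).real A = ((partitionFunction g V β N)⁻¹ *
      ∫⁻ x in A, ENNReal.ofReal (gibbsWeight g V β N x)).toReal := by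
  rw [Measure.real, gibbsMeasure, Measure.smul_apply, withDensity_apply _ hA, smul_eq_mul]

theorem measurable_topParticle {N : ℕ} : Measurable (topParticle : (Fin N → ℝ) → ℝ) := by
  unfold topParticle
  exact Measurable.iSup fun i => measurable_pi_apply i

theorem setLIntegral_gibbsWeight_ne_zero {g V : ℝ → ℝ} (hg : Measurable g) (hV : Measurable V)
    (β : ℝ) (N : ℕ) {A : Set (Fin N → ℝ)} (hA : volume A ≠ 0) :
    ∫⁻ x in A, ENNReal.ofReal (gibbsWeight g V β N x) ≠ 0 := by
  rw [Ne, lintegral_eq_zero_iff (measurable_gibbsWeight hg hV β N).ennreal_ofReal]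
  intro h
  apply hA
  rw [← Measure.restrict_eq_zero, ← ae_eq_bot, ← eventually_false_iff_eq_bot]
  filter_upwards [h] with x hx
  have : 0 < gibbsWeight g V β N x := by rw [gibbsWeight_eq_exp]; exact Real.exp_pos _
  simp only [Pi.zero_apply, ENNReal.ofReal_eq_zero] at hx
  linarith

/-- The left deviation probability is positive, so that its iterated logarithm is meaningful. -/
theorem leftDeviationProb_pos {g V : ℝ → ℝ} (hg : Measurable g) (hV : Measurable V)
    {β κ α t : ℝ} {N : ℕ} (hN : 0 < N) (hZ : partitionFunction g V β N ≠ ⊤)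
    (hE : 0 < (κ⁻¹ * Real.log N) ^ (1 / α)) : 0 < leftDeviationProb g V β κ α N t := by
  set E := (κ⁻¹ * Real.log N) ^ (1 / α) with hEdef
  have : Nonempty (Fin N) := ⟨⟨0, hN⟩⟩
  have hm : MeasurableSet {x : Fin N → ℝ | topParticle x / E < t} :=
    measurableSet_lt (measurable_topParticle.div_const _) measurable_const
  rw [leftDeviationProb, gibbsMeasure_real_apply _ _ _ _ hm]
  have hvol : volume {x : Fin N → ℝ | topParticle x / E < t} ≠ 0 := by
    have hsub : Set.pi Set.univ (fun _ : Fin N => Set.Iio (t * E - 1)) ⊆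
        {x : Fin N → ℝ | topParticle x / E < t} := by
      intro x hx
      have : topParticle x ≤ t * E - 1 := ciSup_le fun i => (hx i trivial).le
      simp only [Set.mem_ofPred_eq]
      rw [div_lt_iff₀ hE]
      linarith
    refine fun h0 => (IsOpen.measure_pos volume (isOpen_set_pi Set.finite_univ
      fun _ _ => isOpen_Iio) ?_).ne' (measure_mono_null hsub h0)
    exact Set.univ_pi_nonempty_iff.2 fun _ => Set.nonempty_Iio
  have hA0 := setLIntegral_gibbsWeight_ne_zero hg hV β N hvol
  have hA1 : ∫⁻ x in {x : Fin N → ℝ | topParticle x / E < t},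
      ENNReal.ofReal (gibbsWeight g V β N x) ≤ partitionFunction g V β N :=
    setLIntegral_le_lintegral _ _
  refine ENNReal.toReal_pos (mul_ne_zero (ENNReal.inv_ne_zero.2 hZ) hA0)
    (ENNReal.mul_ne_top (ENNReal.inv_ne_top.2 fun h0 => hA0 ?_) (ne_top_of_le_ne_top hZ hA1))
  exact le_antisymm (h0 ▸ hA1) zero_le

theorem leftDeviationProb_le_pow {g V : ℝ → ℝ} (hg : Measurable g) (hV : Measurable V)
    {β κ α t ε : ℝ} {N : ℕ}
    (hE : 0 < (κ⁻¹ * Real.log N) ^ (1 / α)) (hε0 : 0 ≤ ε) (hε1 : ε < 1)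
    (h : ∀ (i : Fin N) (x : Fin N → ℝ),
      ENNReal.ofReal ε *
          ∫⁻ y, ENNReal.ofReal (gibbsWeight g V β N (Function.update x i y)) ≤
        ∫⁻ y in Set.Ici (t * (κ⁻¹ * Real.log N) ^ (1 / α)),
          ENNReal.ofReal (gibbsWeight g V β N (Function.update x i y))) :
    leftDeviationProb g V β κ α N t ≤ (1 - ε) ^ N := by
  set E := (κ⁻¹ * Real.log N) ^ (1 / α) with hEdef
  have hm : MeasurableSet {x : Fin N → ℝ | topParticle x / E < t} :=
    measurableSet_lt (measurable_topParticle.div_const _) measurable_const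
  rw [leftDeviationProb, gibbsMeasure_real_apply _ _ _ _ hm]
  have hsub : {x : Fin N → ℝ | topParticle x / E < t} ⊆
      {x | ∀ i ∈ Finset.univ, x i < t * E} := fun x hx i _ => by
    simp only [Set.mem_ofPred_eq] at hx
    rw [div_lt_iff₀ hE] at hx
    exact (le_ciSup (Set.finite_range x).bddAbove i).trans_lt hx
  have h1 := (lintegral_mono_set hsub).trans (setLIntegral_forall_lt_le
    (measurable_gibbsWeight hg hV β N).ennreal_ofReal hε0 hε1 h Finset.univ)
  rw [Finset.card_univ, Fintype.card_fin, ← ENNReal.ofReal_pow (by linarith)] at h1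
  refine ENNReal.toReal_le_of_le_ofReal (pow_nonneg (by linarith) N) ?_
  calc _ ≤ (partitionFunction g V β N)⁻¹ *
        (ENNReal.ofReal ((1 - ε) ^ N) * partitionFunction g V β N) := mul_le_mul_right h1 _
    _ = ENNReal.ofReal ((1 - ε) ^ N) *
        ((partitionFunction g V β N)⁻¹ * partitionFunction g V β N) := by ring
    _ ≤ ENNReal.ofReal ((1 - ε) ^ N) * 1 :=
        mul_le_mul_right (ENNReal.inv_mul_le_one _) _
    _ = _ := mul_one _

/-- If `p ≤ (1 - N ^ (-ρ)) ^ N` then `p ≤ exp (-N ^ (1 - ρ))`. -/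
theorem le_loglog_inv_div_log {p ρ : ℝ} {N : ℕ} (hN : 1 < N) (hp : 0 < p) (hρ : 0 ≤ ρ)
    (h : p ≤ (1 - Real.exp (-ρ * Real.log N)) ^ N) :
    1 - ρ ≤ 1 / Real.log N * Real.log (Real.log (1 / p)) := by
  have hL : 0 < Real.log N := Real.log_pos (by exact_mod_cast hN)
  have hN0 : (0 : ℝ) < N := by exact_mod_cast (zero_lt_one.trans hN)
  have h1 : Real.exp (-ρ * Real.log N) ≤ 1 := Real.exp_le_one_iff.2 (by nlinarith)
  have h2 : p ≤ Real.exp (-Real.exp ((1 - ρ) * Real.log N)) := by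
    refine (h.trans (pow_le_pow_left₀ (by linarith) (Real.one_sub_le_exp_neg _) N)).trans_eq ?_
    rw [← Real.exp_nat_mul, sub_mul, one_mul, sub_eq_add_neg, Real.exp_add, Real.exp_log hN0,
      neg_mul, mul_neg]
  have h3 : Real.exp ((1 - ρ) * Real.log N) ≤ Real.log (1 / p) := by
    have := Real.log_le_log hp h2
    rw [Real.log_exp] at this
    rw [one_div, Real.log_inv]
    linarith
  have h4 := Real.log_le_log (Real.exp_pos _) h3
  rw [Real.log_exp] at h4
  rw [one_div_mul_eq_div, le_div_iff₀ hL]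
  exact h4

/-- The lower bound holds along the whole sequence, not only in the limit superior. -/
theorem eventually_sub_le_loglog_leftDeviationProb {κ α : ℝ} {φ : ℝ → ℝ}
    (hV : PotentialAssumptions κ α φ) {g : ℝ → ℝ} {s c C : ℝ}
    (hg : IsTameInteraction g s c C) (hs0 : 0 < s) (hs1 : s < 1) (hc : 0 ≤ c) (hC : 0 ≤ C)
    {β : ℕ → ℝ} (hβ : ∀ N : ℕ, 1 ≤ N → 0 < β N) {B : ℝ}
    (hβB : ∀ᶠ N : ℕ in atTop, (N : ℝ) * β N ≤ B)
    {r : ℝ} (hr0 : 0 < r) (hr1 : r < 1) {δ : ℝ} (hδ : 0 < δ) :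
    ∀ᶠ N : ℕ in atTop, 1 - (r ^ α + δ) ≤ 1 / Real.log N * Real.log (Real.log (1 /
      leftDeviationProb g (potential κ α φ) (β N) κ α N r)) := by
  have hκ := hV.kappa_pos
  have hα : 0 < α := zero_lt_one.trans_le hV.one_le_alpha
  obtain ⟨K, hK, hsing⟩ := exists_lintegral_abs_sub_rpow_neg_le hs0 hs1
  set V := potential κ α φ with hVdef
  have hJ := (hV.integrable_exp_neg_potential (c * B)).lintegral_lt_top.ne
  rw [← hVdef] at hJ
  set J := (∫⁻ y, ENNReal.ofReal (Real.exp (-V y + c * B * Real.log (1 + |y|)))).toReal with hJdef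
  have hJ0 : 0 ≤ J := ENNReal.toReal_nonneg
  -- Both the excess of the potential over `κ T^α` and the remaining constants and logarithms
  -- are at most `δ' T^α`, and `2 δ' T^α = δ r^α log N`.
  set δ' := δ * κ / 2 with hδ'
  have hδ'0 : 0 < δ' := by positivity
  have hlog : Tendsto (fun N : ℕ => Real.log N) atTop atTop :=
    Real.tendsto_log_atTop.comp tendsto_natCast_atTop_atTop
  have hT : Tendsto (fun N : ℕ => r * (κ⁻¹ * Real.log N) ^ (1 / α)) atTop atTop :=
    ((tendsto_rpow_atTop (by positivity)).comp
      (hlog.const_mul_atTop (inv_pos.2 hκ))).const_mul_atTop hr0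
  filter_upwards [hT.eventually (hV.eventually_potential_le hδ'0),
    hT.eventually (eventually_add_mul_log_le_mul_rpow hV.one_le_alpha
      (Real.log (J + 1) + Real.log 2 + C * B * (1 + 2 * K)) (c * B) hδ'0),
    hβB, eventually_gt_atTop 1] with N hv hA hB hN
  have hL : 0 < Real.log N := Real.log_pos (by exact_mod_cast hN)
  have hE : 0 < (κ⁻¹ * Real.log N) ^ (1 / α) := by positivity
  have hβN := hβ N hN.le
  have hZ := partitionFunction_ne_top hV hg hc hβN.le N
  have hTα : (r * (κ⁻¹ * Real.log N) ^ (1 / α)) ^ α = r ^ α * (κ⁻¹ * Real.log N) := by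
    rw [Real.mul_rpow hr0.le hE.le, ← Real.rpow_mul (by positivity),
      one_div_mul_cancel hα.ne', Real.rpow_one]
  rw [hTα] at hv hA
  have hrα0 : 0 < r ^ α := by positivity
  have hrα1 : r ^ α ≤ 1 := Real.rpow_le_one hr0.le hr1.le hα.le
  refine le_loglog_inv_div_log hN
    (leftDeviationProb_pos (V := V) hg.measurable hV.measurable_potential (by omega) hZ hE)
    (by positivity)
    (leftDeviationProb_le_pow (V := V) hg.measurable hV.measurable_potential hE (Real.exp_pos _).le
      ?_ fun i x => ?_)
  · rw [Real.exp_lt_one_iff]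
    nlinarith
  · obtain ⟨D, hD, hw⟩ := exists_gibbsWeight_update_eq (V := V) hg.even (β N) N x i
    simp_rw [hw, ENNReal.ofReal_mul hD]
    rw [lintegral_const_mul' _ _ ENNReal.ofReal_ne_top,
      lintegral_const_mul' _ _ ENNReal.ofReal_ne_top, mul_left_comm]
    refine mul_le_mul_right (ofReal_mul_lintegral_le_setLIntegral_Ici hg hC hc hβN.le hK
      (by positivity) hsing hJ hv _ ?_ x (Real.exp_pos _).le ?_) _
    · have : (((Finset.univ.erase i).card : ℕ) : ℝ) + 1 = N := by
        rw [← Nat.cast_add_one, Finset.card_erase_add_one (Finset.mem_univ i), Finset.card_univ,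
          Fintype.card_fin]
      rw [this, mul_comm]
      exact hB
    · rw [← hJdef]
      have e1 : J ≤ Real.exp (Real.log (J + 1)) := by
        rw [Real.exp_log (by linarith)]; linarith
      have e2 : (2 : ℝ)⁻¹ = Real.exp (-Real.log 2) := by
        rw [Real.exp_neg, Real.exp_log two_pos]
      refine (mul_le_mul_of_nonneg_left e1 (Real.exp_pos _).le).trans ?_
      rw [e2, ← Real.exp_add, ← Real.exp_add]
      apply Real.exp_le_exp.2
      have e3 : (κ + 2 * δ') * (r ^ α * (κ⁻¹ * Real.log N)) =
          r ^ α * Real.log N + r ^ α * (δ * Real.log N) := by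
        rw [hδ']; field_simp
      have e4 : r ^ α * (δ * Real.log N) ≤ δ * Real.log N :=
        mul_le_of_le_one_left (by positivity) hrα1
      linarith

theorem exists_isTameInteraction {g : ℝ → ℝ}
    (hg : g = logInteraction ∨ ∃ s : ℝ, 0 < s ∧ s < 1 ∧ g = rieszInteraction s) :
    ∃ s c C : ℝ, 0 < s ∧ s < 1 ∧ 0 ≤ c ∧ 0 ≤ C ∧ IsTameInteraction g s c C := by
  rcases hg with rfl | ⟨s, hs0, hs1, rfl⟩
  · exact ⟨1 / 2, 1, 4, by norm_num, by norm_num, by norm_num, by norm_num,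
      isTameInteraction_logInteraction⟩
  · exact ⟨s, 0, 1, hs0, hs1, le_rfl, zero_le_one, isTameInteraction_rieszInteraction s⟩

end RieszGas

theorem theorem1p3 (κ α : ℝ) (φ : ℝ → ℝ) (hV : RieszGas.PotentialAssumptions κ α φ)
    (g : ℝ → ℝ)
    (hg : g = RieszGas.logInteraction ∨
      ∃ s : ℝ, 0 < s ∧ s < 1 ∧ g = RieszGas.rieszInteraction s)
    (β : ℕ → ℝ) (hβ : ∀ N : ℕ, 1 ≤ N → 0 < β N)
    (P : ℝ) (hP : 0 < P) (hβP : Tendsto (fun N : ℕ => (N : ℝ) * β N) atTop (𝓝 (2 * P)))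
    (x : ℝ) (hx0 : 0 < x) (hx1 : x < 1) :
    ((1 - (1 - x) ^ α : ℝ) : EReal) ≤
      limsup (fun N : ℕ =>
        ((1 / Real.log N * Real.log (Real.log (1 /
          RieszGas.leftDeviationProb g (RieszGas.potential κ α φ) (β N) κ α N (1 - x))) : ℝ) :
          EReal)) atTop := by
  obtain ⟨s, c, C, hs0, hs1, hc, hC, hg'⟩ := RieszGas.exists_isTameInteraction hg
  refine EReal.ge_of_forall_gt_iff_ge.1 fun b hb => ?_
  have hb' : b < 1 - (1 - x) ^ α := by exact_mod_cast hb
  have := RieszGas.eventually_sub_le_loglog_leftDeviationProb hV hg' hs0 hs1 hc hC hβ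
    (hβP.eventually_le_const (lt_add_one (2 * P))) (sub_pos.2 hx1) (by linarith : 1 - x < 1)
    (sub_pos.2 hb')
  refine le_limsup_of_frequently_le (Eventually.frequently ?_)
  filter_upwards [this] with N hN
  rw [EReal.coe_le_coe_iff]
  linarith
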